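/- **Proposition (Properties of the Weyl product).** Let $d\in\mathbb N_0$, $\varepsilon>0$, $\Xi=\mathbb R^d_x\times\mathbb R^d_\xi$, and $\sigma((x,\xi),(y,\eta))=\xi\cdot y-x\cdot\eta$. For $f\in\mathcal S(\Xi)$ let $$(\mathcal F_\sigma f)(X)=\frac1{(2\pi)^d}\int_\Xi e^{i\sigma(X,Y)}f(Y)\,dY$$ be the symplectic Fourier transform, and for $f,g\in\mathcal S(\Xi)$ let $$(f\sharp g)(X)=\frac1{(2\pi)^{2d}}\int_\Xi dY\int_\Xi dZ\;e^{i\sigma(X,Y+Z)}\,e^{i\frac{\varepsilon}{2}\sigma(Y,Z)}\,(\mathcal F_\sigma f)(Y)\,(\mathcal F_\sigma g)(Z)$$ be the Weyl product. Then, for all $f,g,h\in\mathcal S(\Xi)$ and $\alpha\in\mathbb C$, the function $f\sharp g$ belongs to $\mathcal S(\Xi)$ and 1. (bilinearity) $(f+\alpha g)\sharp h=f\sharp h+\alpha\,(g\sharp h)$ and $f\sharp(g+\alpha h)=f\sharp g+\alpha\,(f\sharp h)$; 2. (associativity) $(f\sharp g)\sharp h=f\sharp(g\sharp h)$; 3.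 (position) if $f$ and $g$ depend only on $x$, then $f\sharp g=f\,g$; 4. (momentum) if $f$ and $g$ depend only on $\xi$, then $f\sharp g=f\,g$. For $d\ge1$ a Schwartz function on $\Xi$ that depends only on $x$, or only on $\xi$, vanishes, so that 3 and 4 are of interest only for symbols that do not decay. They hold for these as well. Let $a,b:\mathbb R^d\to\mathbb C$ be smooth functions of temperate growth (each derivative is bounded by a polynomial), and let either $f(x,\xi)=a(x)$, $g(x,\xi)=b(x)$ or $f(x,\xi)=a(\xi)$, $g(x,\xi)=b(\xi)$. Then $f\sharp g=f\,g$ in the sense of oscillatory integrals: for all $\chi,\psi\in\mathcal S(\Xi)$ with $\chi(0)=\psi(0)=1$ and all $X\in\Xi$, $$\lim_{\delta,\delta'\to0^+}\bigl((\chi(\delta\,\cdot\,)f)\,\sharp\,(\psi(\delta'\,\cdot\,)g)\bigr)(X)=f(X)\,g(X).$$ -/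

import Mathlib

open MeasureTheory Filter Topology
open scoped SchwartzMap

noncomputable section

/-- Phase space `ℝᵈ × ℝᵈ`; a point is `X = (x, ξ)` with position `x = X.1` and momentum
`ξ = X.2`. -/
abbrev PhaseSpace (d : ℕ) : Type :=
  EuclideanSpace ℝ (Fin d) × EuclideanSpace ℝ (Fin d)

/-- The symplectic form `σ((x, ξ), (y, η)) = ξ ⬝ y - x ⬝ η`. -/
def symplecticForm {d : ℕ} (X Y : PhaseSpace d) : ℝ :=
  inner ℝ X.2 Y.1 - inner ℝ X.1 Y.2

/-- The symplectic Fourier transform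
`(𝓕_σ f)(X) = (2π)⁻ᵈ ∫ e^{i σ(X, Y)} f(Y) dY`. -/
def symplecticFourier {d : ℕ} (f : PhaseSpace d → ℂ) (X : PhaseSpace d) : ℂ :=
  ((2 * Real.pi : ℝ) : ℂ)⁻¹ ^ d *
    ∫ Y : PhaseSpace d, Complex.exp (Complex.I * (symplecticForm X Y : ℂ)) * f Y

/-- The Weyl product with semiclassical parameter `ε`:
`(f ♯ g)(X) = (2π)⁻²ᵈ ∫ dY ∫ dZ e^{i σ(X, Y + Z)} e^{i (ε/2) σ(Y, Z)} (𝓕_σ f)(Y) (𝓕_σ g)(Z)`. -/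
def weylProduct {d : ℕ} (ε : ℝ) (f g : PhaseSpace d → ℂ) (X : PhaseSpace d) : ℂ :=
  ((2 * Real.pi : ℝ) : ℂ)⁻¹ ^ (2 * d) *
    ∫ Y : PhaseSpace d, ∫ Z : PhaseSpace d,
      Complex.exp (Complex.I * (symplecticForm X (Y + Z) : ℂ)) *
        Complex.exp (Complex.I * ((ε / 2 * symplecticForm Y Z : ℝ) : ℂ)) *
          symplecticFourier f Y * symplecticFourier g Z

/-- `p` is the Weyl product of the symbols `f` and `g`, which need not decay, in the sense of
oscillatory integrals: whenever `f` and `g` are cut off by Schwartz functions `χ (δ ·)` and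
`ψ (δ' ·)` with `χ 0 = ψ 0 = 1`, the Weyl products of the cut-off symbols converge pointwise
to `p` as `δ, δ' → 0⁺`, independently of each other. -/
def IsOscillatoryWeylProduct {d : ℕ} (ε : ℝ) (f g p : PhaseSpace d → ℂ) : Prop :=
  ∀ χ ψ : 𝓢(PhaseSpace d, ℂ), χ 0 = 1 → ψ 0 = 1 → ∀ X : PhaseSpace d,
    Tendsto
      (fun δ : ℝ × ℝ =>
        weylProduct ε (fun Y => χ (δ.1 • Y) * f Y) (fun Z => ψ (δ.2 • Z) * g Z) X)
      (𝓝[>] (0 : ℝ) ×ˢ 𝓝[>] (0 : ℝ)) (𝓝 (p X))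

end

/-! The symplectic Fourier transform is an involution, so either inner integral of the Weyl product
can be carried out. Up to the factor `(2π)⁻ᵈ`, this gives `∫ e^{iσ(X,Y)} g(X + (ε/2)Y) (𝓕_σ f)(Y)
dY` (`weylProduct_eq_integral_left`) or `∫ e^{iσ(X,Z)} f(X - (ε/2)Z) (𝓕_σ g)(Z) dZ`
(`weylProduct_eq_integral_right`). The first integrand is Schwartz in `(X, Y)` jointly, so `f ♯ g`
is Schwartz by `SchwartzMap.exists_integral_fiber`. Associativity follows by Fubini, since the
phases agree (`symplecticForm_phase`).

For symbols of position, integrating `𝓕_σ f` against a weight in `y` alone pins the position at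
`X.1` (`integral_mul_symplecticFourier`), so a factor `a(x)` comes out as a constant. This and a
rescaling turn the product of the cut-off symbols into an integral against `𝓕_σ ψ ⊗ 𝓕_σ χ`
(`weylProduct_cutoff`). Dominated convergence then gives `a b χ(0) ψ(0)`. Momentum reduces to
position by the symplectic rotation `phaseRotation`. -/

section TemperateGrowth

variable {D E F : Type*} [NormedAddCommGroup D] [NormedSpace ℝ D]
  [NormedAddCommGroup E] [NormedSpace ℝ E] [NormedAddCommGroup F] [NormedSpace ℝ F]

@[fun_prop]
lemma Function.HasTemperateGrowth.fst {f : D → E × F} (hf : f.HasTemperateGrowth) :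
    (fun x => (f x).1).HasTemperateGrowth :=
  (ContinuousLinearMap.fst ℝ E F).hasTemperateGrowth.comp hf

@[fun_prop]
lemma Function.HasTemperateGrowth.snd {f : D → E × F} (hf : f.HasTemperateGrowth) :
    (fun x => (f x).2).HasTemperateGrowth :=
  (ContinuousLinearMap.snd ℝ E F).hasTemperateGrowth.comp hf

@[fun_prop]
lemma Function.HasTemperateGrowth.real_smul {f : D → E} (hf : f.HasTemperateGrowth) (r : ℝ) :
    (fun x => r • f x).HasTemperateGrowth :=
  (ContinuousLinearMap.lsmul ℝ ℝ r : E →L[ℝ] E).hasTemperateGrowth.comp hf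

@[fun_prop]
lemma Function.HasTemperateGrowth.real_inner {E : Type*} [NormedAddCommGroup E]
    [InnerProductSpace ℝ E] {f g : D → E} (hf : f.HasTemperateGrowth)
    (hg : g.HasTemperateGrowth) : (fun x => inner ℝ (f x) (g x)).HasTemperateGrowth :=
  (innerSL ℝ : E →L[ℝ] E →L[ℝ] ℝ).bilinear_hasTemperateGrowth hf hg

lemma hasTemperateGrowth_cexp_I_mul :
    (fun t : ℝ => Complex.exp (Complex.I * (t : ℂ))).HasTemperateGrowth := by
  have hd : ∀ n : ℕ, iteratedDeriv n (fun t : ℝ => Complex.exp (Complex.I * (t : ℂ))) =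
      fun t : ℝ => Complex.I ^ n * Complex.exp (Complex.I * (t : ℂ)) := by
    intro n
    induction n with
    | zero => simp
    | succ n ih =>
      rw [iteratedDeriv_succ, ih]
      ext t
      have h : HasDerivAt (fun t : ℝ => Complex.exp (Complex.I * (t : ℂ)))
          (Complex.exp (Complex.I * (t : ℂ)) * (Complex.I * 1)) t :=
        (((hasDerivAt_id (t : ℂ)).const_mul Complex.I).cexp).comp_ofReal
      rw [(h.const_mul (Complex.I ^ n)).deriv]
      ring
  -- Every derivative has modulus one, so degree 0 and constant 1 serve for all orders.
  refine ⟨(contDiff_const.mul Complex.ofRealCLM.contDiff).cexp, fun n => ⟨0, 1, fun t => ?_⟩⟩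
  rw [norm_iteratedFDeriv_eq_norm_iteratedDeriv, hd]
  simp [mul_comm Complex.I, Complex.norm_exp_ofReal_mul_I]

@[fun_prop]
lemma Function.HasTemperateGrowth.cexp_I_mul {θ : D → ℝ} (hθ : θ.HasTemperateGrowth) :
    (fun x => Complex.exp (Complex.I * (θ x : ℂ))).HasTemperateGrowth :=
  hasTemperateGrowth_cexp_I_mul.comp hθ

end TemperateGrowth

/-! ### Exterior products and fibre integrals of Schwartz functions. -/

namespace SchwartzMap

variable {D E F G : Type*} [NormedAddCommGroup D] [NormedSpace ℝ D]
  [NormedAddCommGroup E] [NormedSpace ℝ E]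

lemma norm_iteratedFDeriv_comp_le_of_norm_le_one [NormedAddCommGroup F] [NormedSpace ℝ F]
    {f : E → F} (hf : ContDiff ℝ (⊤ : ℕ∞) f) (L : D →L[ℝ] E) (hL : ‖L‖ ≤ 1) (x : D) (n : ℕ) :
    ‖iteratedFDeriv ℝ n (f ∘ L) x‖ ≤ ‖iteratedFDeriv ℝ n f (L x)‖ := by
  rw [L.iteratedFDeriv_comp_right hf x (mod_cast le_top)]
  refine (ContinuousMultilinearMap.norm_compContinuousLinearMap_le _ _).trans ?_
  exact mul_le_of_le_one_right (norm_nonneg _)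
    (Finset.prod_le_one (fun _ _ => norm_nonneg _) fun _ _ => hL)

/-- The exterior product `(x, y) ↦ f x * g y` of two Schwartz functions is a Schwartz function. -/
lemma exists_prod_mul (f : 𝓢(D, ℂ)) (g : 𝓢(E, ℂ)) :
    ∃ H : 𝓢(D × E, ℂ), ∀ p, H p = f p.1 * g p.2 := by
  have hf := (f.smooth ⊤).comp (contDiff_fst (E := D) (F := E))
  have hg := (g.smooth ⊤).comp (contDiff_snd (E := D) (F := E))
  refine ⟨⟨fun p => f p.1 * g p.2, hf.mul hg, fun k n => ⟨∑ i ∈ Finset.range (n + 1),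
    (n.choose i : ℝ) * (SchwartzMap.seminorm ℝ k i f * SchwartzMap.seminorm ℝ 0 (n - i) g +
      SchwartzMap.seminorm ℝ 0 i f * SchwartzMap.seminorm ℝ k (n - i) g), fun p => ?_⟩⟩,
    fun _ => rfl⟩
  refine (mul_le_mul_of_nonneg_left (norm_iteratedFDeriv_mul_le hf hg p (mod_cast le_top))
    (by positivity)).trans ?_
  rw [Finset.mul_sum]
  refine Finset.sum_le_sum fun i _ => ?_
  have hf' : ‖iteratedFDeriv ℝ i (f ∘ Prod.fst) p‖ ≤ ‖iteratedFDeriv ℝ i f p.1‖ :=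
    norm_iteratedFDeriv_comp_le_of_norm_le_one (f.smooth ⊤) (.fst ℝ D E)
      (ContinuousLinearMap.norm_fst_le ℝ D E) p i
  have hg' : ‖iteratedFDeriv ℝ (n - i) (g ∘ Prod.snd) p‖ ≤ ‖iteratedFDeriv ℝ (n - i) g p.2‖ :=
    norm_iteratedFDeriv_comp_le_of_norm_le_one (g.smooth ⊤) (.snd ℝ D E)
      (ContinuousLinearMap.norm_snd_le ℝ D E) p (n - i)
  -- In the sup norm the weight falls on one factor at a time; the other factor only has to be
  -- bounded.
  have hp : ‖p‖ ^ k ≤ ‖p.1‖ ^ k + ‖p.2‖ ^ k := by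
    rcases le_total ‖p.1‖ ‖p.2‖ with h | h
    · rw [Prod.norm_def, max_eq_right h]
      exact le_add_of_nonneg_left (by positivity)
    · rw [Prod.norm_def, max_eq_left h]
      exact le_add_of_nonneg_right (by positivity)
  calc _ ≤ (‖p.1‖ ^ k + ‖p.2‖ ^ k) * ((n.choose i : ℝ) * ‖iteratedFDeriv ℝ i f p.1‖ *
        ‖iteratedFDeriv ℝ (n - i) g p.2‖) := by gcongr
    _ = (n.choose i : ℝ) * ((‖p.1‖ ^ k * ‖iteratedFDeriv ℝ i f p.1‖) *
        ‖iteratedFDeriv ℝ (n - i) g p.2‖ + ‖iteratedFDeriv ℝ i f p.1‖ *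
        (‖p.2‖ ^ k * ‖iteratedFDeriv ℝ (n - i) g p.2‖)) := by ring
    _ ≤ _ := by
      gcongr
      · exact le_seminorm ℝ k i f p.1
      · exact norm_iteratedFDeriv_le_seminorm ℝ g (n - i) p.2
      · exact norm_iteratedFDeriv_le_seminorm ℝ f i p.1
      · exact le_seminorm ℝ k (n - i) g p.2

/-- The product of a function of temperate growth with the exterior product of two Schwartz
functions is a Schwartz function. -/
lemma exists_temperate_mul_prod_mul (f : 𝓢(D, ℂ)) (g : 𝓢(E, ℂ)) {m : D × E → ℂ}
    (hm : m.HasTemperateGrowth) :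
    ∃ H : 𝓢(D × E, ℂ), ∀ p, H p = m p * (f p.1 * g p.2) := by
  obtain ⟨H, hH⟩ := exists_prod_mul f g
  exact ⟨smulLeftCLM ℂ m H, fun p => by simp [hm, hH]⟩

lemma exists_temperate_mul (f : 𝓢(D, ℂ)) {m : D → ℂ} (hm : m.HasTemperateGrowth) :
    ∃ H : 𝓢(D, ℂ), ∀ x, H x = m x * f x :=
  ⟨smulLeftCLM ℂ m f, fun p => by simp [hm]⟩

section FiberIntegral

variable [NormedAddCommGroup G] [NormedSpace ℝ G] [MeasurableSpace E]

/-- Decay of order `k + l` in the joint variable pays for `‖x‖ ^ k` and for `l` powers of `‖y‖`,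
enough for integrability. Uniformity in `x` serves both differentiation under the integral and
decay. -/
lemma exists_fiber_bound (μ : Measure E) [μ.HasTemperateGrowth] (H : 𝓢(D × E, G)) (k : ℕ) :
    ∃ b : E → ℝ, Integrable b μ ∧ ∀ x y, ‖x‖ ^ k * ‖H (x, y)‖ ≤ b y := by
  set l := μ.integrablePower
  refine ⟨fun y => 2 ^ l * (SchwartzMap.seminorm ℝ k 0 H + SchwartzMap.seminorm ℝ (k + l) 0 H) *
    (1 + ‖y‖) ^ (-(l : ℝ)), (Measure.integrable_pow_neg_integrablePower μ).const_mul _, fun x y => ?_⟩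
  have hx : ‖x‖ ≤ ‖(x, y)‖ := le_max_left _ _
  have hy : ‖y‖ ≤ ‖(x, y)‖ := le_max_right _ _
  have := pow_mul_le_of_le_of_pow_mul_le (k := 0) (l := l) (norm_nonneg y)
    (f := ‖x‖ ^ k * ‖H (x, y)‖) (by positivity)
    (C₁ := SchwartzMap.seminorm ℝ k 0 H) (C₂ := SchwartzMap.seminorm ℝ (k + l) 0 H)
    ((by gcongr : _ ≤ ‖(x, y)‖ ^ k * ‖H (x, y)‖).trans (norm_pow_mul_le_seminorm ℝ H k _))
    ((?_ : _ ≤ ‖(x, y)‖ ^ (k + l) * ‖H (x, y)‖).trans (norm_pow_mul_le_seminorm ℝ H (k + l) _))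
  · simpa using this
  · rw [zero_add, pow_add, ← mul_assoc, mul_comm (‖y‖ ^ l)]
    gcongr

variable [BorelSpace E] [FiniteDimensional ℝ E]

lemma integrable_fiber (μ : Measure E) [μ.HasTemperateGrowth] (H : 𝓢(D × E, G)) (x : D) :
    Integrable (fun y => H (x, y)) μ := by
  obtain ⟨b, hb, hle⟩ := exists_fiber_bound μ H 0
  refine hb.mono' (Continuous.aestronglyMeasurable (by fun_prop)) (ae_of_all _ fun y => ?_)
  simpa using hle x y

/-- The derivative is again a fibre integral of a Schwartz function, so smoothness and decay follow
by induction on the order. -/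
lemma hasFDerivAt_integral_fiber (μ : Measure E) [μ.HasTemperateGrowth]
    (H : 𝓢(D × E, G)) (x : D) :
    HasFDerivAt (fun x => ∫ y, H (x, y) ∂μ) (∫ y,
      postcompCLM ((ContinuousLinearMap.compL ℝ D (D × E) G).flip (.inl ℝ D E))
        (fderivCLM ℝ (D × E) G H) (x, y) ∂μ) x := by
  set H' : 𝓢(D × E, D →L[ℝ] G) :=
    postcompCLM ((ContinuousLinearMap.compL ℝ D (D × E) G).flip (.inl ℝ D E))
      (fderivCLM ℝ (D × E) G H)
  obtain ⟨b, hb, hle⟩ := exists_fiber_bound μ H' 0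
  refine hasFDerivAt_integral_of_dominated_of_fderiv_le (F := fun x y => H (x, y))
    (F' := fun x y => H' (x, y)) (bound := b) Filter.univ_mem
    (.of_forall fun x => Continuous.aestronglyMeasurable (by fun_prop)) (H.integrable_fiber μ x)
    (Continuous.aestronglyMeasurable (by fun_prop)) (ae_of_all _ fun y x _ => ?_) hb
    (ae_of_all _ fun y x _ => ?_)
  · simpa using hle x y
  · have h := HasFDerivAt.comp (f := fun x => (x, y)) x (H.hasFDerivAt (x, y))
      (hasFDerivAt_prodMk_left x y)
    simpa [H', Function.comp_def] using h

end FiberIntegral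

section
universe u v
variable {D : Type u} {G : Type max u v} [NormedAddCommGroup D] [NormedSpace ℝ D]
  [NormedAddCommGroup G] [NormedSpace ℝ G] [MeasurableSpace E] [BorelSpace E]
  [FiniteDimensional ℝ E]

lemma differentiable_integral_fiber (μ : Measure E) [μ.HasTemperateGrowth] (H : 𝓢(D × E, G)) :
    Differentiable ℝ (fun x => ∫ y, H (x, y) ∂μ) := fun x =>
  (H.hasFDerivAt_integral_fiber μ x).differentiableAt

/-- The induction replaces the target `G` by `D →L[ℝ] G`, which must stay in the same universe;
hence `G : Type max u v`. -/
lemma contDiff_integral_fiber (μ : Measure E) [μ.HasTemperateGrowth] (n : ℕ)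
    (H : 𝓢(D × E, G)) : ContDiff ℝ n (fun x => ∫ y, H (x, y) ∂μ) := by
  induction n generalizing G with
  | zero => exact contDiff_zero.2 (H.differentiable_integral_fiber μ).continuous
  | succ n ih =>
    refine contDiff_succ_iff_fderiv.2 ⟨H.differentiable_integral_fiber μ,
      fun h => absurd h (WithTop.natCast_ne_top n), ?_⟩
    rw [funext fun x => (H.hasFDerivAt_integral_fiber μ x).fderiv]
    exact ih _

lemma decay_integral_fiber (μ : Measure E) [μ.HasTemperateGrowth] (k n : ℕ) (H : 𝓢(D × E, G)) :
    ∃ C : ℝ, ∀ x, ‖x‖ ^ k * ‖iteratedFDeriv ℝ n (fun x => ∫ y, H (x, y) ∂μ) x‖ ≤ C := by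
  induction n generalizing G with
  | zero =>
    obtain ⟨b, hb, hle⟩ := exists_fiber_bound μ H k
    refine ⟨∫ y, b y ∂μ, fun x => ?_⟩
    rw [norm_iteratedFDeriv_zero]
    calc _ ≤ ‖x‖ ^ k * ∫ y, ‖H (x, y)‖ ∂μ := by gcongr; exact norm_integral_le_integral_norm _
      _ = ∫ y, ‖x‖ ^ k * ‖H (x, y)‖ ∂μ := (integral_const_mul _ _).symm
      _ ≤ _ := integral_mono ((H.integrable_fiber μ x).norm.const_mul _) hb (hle x)
  | succ n ih =>
    obtain ⟨C, hC⟩ := ih (postcompCLM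
      ((ContinuousLinearMap.compL ℝ D (D × E) G).flip (.inl ℝ D E)) (fderivCLM ℝ (D × E) G H))
    refine ⟨C, fun x => ?_⟩
    rw [← norm_iteratedFDeriv_fderiv, funext fun x => (H.hasFDerivAt_integral_fiber μ x).fderiv]
    exact hC x

/-- Integrating a Schwartz function over one factor of a product yields a Schwartz function. -/
lemma exists_integral_fiber (μ : Measure E) [μ.HasTemperateGrowth] (H : 𝓢(D × E, G)) :
    ∃ T : 𝓢(D, G), ∀ x, T x = ∫ y, H (x, y) ∂μ :=
  ⟨⟨_, contDiff_infty.2 fun n => H.contDiff_integral_fiber μ n,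
    fun k n => H.decay_integral_fiber μ k n⟩, fun _ => rfl⟩

end

end SchwartzMap

/-! ### Fourier inversion without `2π` in the exponent. -/

section FourierInversion

open FourierTransform

variable {d : ℕ}

lemma fourier_inversion (h : 𝓢(EuclideanSpace ℝ (Fin d), ℂ)) (x : EuclideanSpace ℝ (Fin d)) :
    ((2 * Real.pi : ℝ) : ℂ)⁻¹ ^ d * ∫ w : EuclideanSpace ℝ (Fin d),
      Complex.exp (Complex.I * (inner ℝ x w : ℝ)) *
        ∫ v : EuclideanSpace ℝ (Fin d), Complex.exp (Complex.I * (-inner ℝ w v : ℝ)) * h v =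
      h x := by
  have h1 : ∀ w : EuclideanSpace ℝ (Fin d),
      Complex.exp (Complex.I * (inner ℝ x w : ℝ)) *
        ∫ v : EuclideanSpace ℝ (Fin d), Complex.exp (Complex.I * (-inner ℝ w v : ℝ)) * h v =
      (fun u => Complex.exp ((2 * Real.pi * inner ℝ u x : ℝ) * Complex.I) • 𝓕 (h : _ → ℂ) u)
        ((2 * Real.pi)⁻¹ • w) := by
    intro w
    simp only [Real.fourier_eq', smul_eq_mul]
    congr 2
    · rw [real_inner_smul_left, real_inner_comm, mul_inv_cancel_left₀ (by positivity), mul_comm]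
    · ext v
      congr 2
      rw [real_inner_smul_right, real_inner_comm, mul_comm Complex.I, neg_mul, neg_mul,
        mul_inv_cancel_left₀ (by positivity)]
  rw [integral_congr_ae (ae_of_all _ h1), Measure.integral_comp_smul volume
    (fun u => Complex.exp ((2 * Real.pi * inner ℝ u x : ℝ) * Complex.I) • 𝓕 (h : _ → ℂ) u),
    ← Real.fourierInv_eq', ← SchwartzMap.fourier_coe,
    ← SchwartzMap.fourierInv_coe, fourierInv_fourier_eq, finrank_euclideanSpace_fin,
    abs_of_pos (by positivity), inv_pow, inv_pow, inv_inv, Complex.real_smul, ← mul_assoc,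
    Complex.ofReal_pow, inv_mul_cancel₀ (by simp [Real.pi_ne_zero]), one_mul]

lemma fourier_inversion' (h : 𝓢(EuclideanSpace ℝ (Fin d), ℂ)) (x : EuclideanSpace ℝ (Fin d)) :
    ((2 * Real.pi : ℝ) : ℂ)⁻¹ ^ d * ∫ w : EuclideanSpace ℝ (Fin d),
      Complex.exp (Complex.I * (-inner ℝ x w : ℝ)) *
        ∫ v : EuclideanSpace ℝ (Fin d), Complex.exp (Complex.I * (inner ℝ w v : ℝ)) * h v =
      h x := by
  rw [← fourier_inversion h x, ← integral_neg_eq_self]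
  simp

end FourierInversion

/-! ### The symplectic Fourier transform. -/

section SymplecticFourier

variable {d : ℕ}

@[fun_prop]
lemma Function.HasTemperateGrowth.symplecticForm {D : Type*} [NormedAddCommGroup D]
    [NormedSpace ℝ D] {f g : D → PhaseSpace d} (hf : f.HasTemperateGrowth)
    (hg : g.HasTemperateGrowth) : (fun x => symplecticForm (f x) (g x)).HasTemperateGrowth := by
  unfold _root_.symplecticForm
  fun_prop

lemma symplecticForm_add_right (X Y Z : PhaseSpace d) :
    symplecticForm X (Y + Z) = symplecticForm X Y + symplecticForm X Z := by
  simp only [symplecticForm, Prod.fst_add, Prod.snd_add, inner_add_right]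
  ring

lemma symplecticForm_add_left (X Y Z : PhaseSpace d) :
    symplecticForm (X + Y) Z = symplecticForm X Z + symplecticForm Y Z := by
  simp only [symplecticForm, Prod.fst_add, Prod.snd_add, inner_add_left]
  ring

lemma symplecticForm_smul_right (r : ℝ) (X Y : PhaseSpace d) :
    symplecticForm X (r • Y) = r * symplecticForm X Y := by
  simp only [symplecticForm, Prod.smul_fst, Prod.smul_snd, real_inner_smul_right]
  ring

lemma symplecticForm_smul_left (r : ℝ) (X Y : PhaseSpace d) :
    symplecticForm (r • X) Y = r * symplecticForm X Y := by
  simp only [symplecticForm, Prod.smul_fst, Prod.smul_snd, real_inner_smul_left]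
  ring

lemma symplecticForm_sub_left (X Y Z : PhaseSpace d) :
    symplecticForm (X - Y) Z = symplecticForm X Z - symplecticForm Y Z := by
  simp only [symplecticForm, Prod.fst_sub, Prod.snd_sub, inner_sub_left]
  ring

lemma symplecticForm_swap (X Y : PhaseSpace d) :
    symplecticForm X Y = -symplecticForm Y X := by
  simp only [symplecticForm, real_inner_comm]
  ring

/-- The rotation `(x, ξ) ↦ (ξ, -x)` of phase space, which exchanges position and momentum. -/
noncomputable def phaseRotation (d : ℕ) : PhaseSpace d ≃L[ℝ] PhaseSpace d :=
  (ContinuousLinearEquiv.prodComm ℝ _ _).trans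
    ((ContinuousLinearEquiv.refl ℝ _).prodCongr (ContinuousLinearEquiv.neg ℝ))

@[simp]
lemma phaseRotation_apply (X : PhaseSpace d) : phaseRotation d X = (X.2, -X.1) := rfl

lemma symplecticForm_phaseRotation (X Y : PhaseSpace d) :
    symplecticForm (phaseRotation d X) (phaseRotation d Y) = symplecticForm X Y := by
  simp [symplecticForm]
  ring

open FourierTransform in
/-- The symplectic Fourier transform of a Schwartz function is a Schwartz function. -/
lemma exists_schwartz_symplecticFourier (f : 𝓢(PhaseSpace d, ℂ)) :
    ∃ F : 𝓢(PhaseSpace d, ℂ), ⇑F = symplecticFourier f := by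
  -- The sup-norm product has no inner product, so the transform is taken on the `L²` product. As
  -- `σ(X, Y)` pairs `(ξ, -x)` with `Y`, the frequency is the rotated `X` times `-(2π)⁻¹`.
  let e := WithLp.prodContinuousLinearEquiv 2 ℝ (EuclideanSpace ℝ (Fin d))
    (EuclideanSpace ℝ (Fin d))
  let u : ℝˣ := Units.mk0 (-(2 * Real.pi)⁻¹) (by simp [Real.pi_ne_zero])
  let L := (phaseRotation d).trans ((ContinuousLinearEquiv.smulLeft u).trans e.symm)
  refine ⟨((2 * Real.pi : ℝ) : ℂ)⁻¹ ^ d • SchwartzMap.compCLMOfContinuousLinearEquiv ℂ L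
    (𝓕 (SchwartzMap.compCLMOfContinuousLinearEquiv ℂ e f)), funext fun X => ?_⟩
  simp only [symplecticFourier, smul_apply, smul_eq_mul,
    SchwartzMap.compCLMOfContinuousLinearEquiv_apply, Function.comp_apply,
    SchwartzMap.fourier_coe, Real.fourier_eq']
  congr 1
  rw [← (WithLp.volume_preserving_ofLp (EuclideanSpace ℝ (Fin d))
    (EuclideanSpace ℝ (Fin d))).integral_comp (MeasurableEquiv.toLp 2 _).symm.measurableEmbedding]
  congr 1 with v
  congr 2
  rw [mul_comm]
  congr 2
  simp [L, e, u, symplecticForm, WithLp.prod_inner_apply, Units.smul_def, inner_smul_right]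
  field_simp
  simp only [real_inner_comm]
  ring

instance : (volume : Measure (PhaseSpace d)).IsAddHaarMeasure :=
  Measure.prod.instIsAddHaarMeasure volume volume

instance : (volume : Measure (PhaseSpace d × PhaseSpace d)).IsAddHaarMeasure :=
  Measure.prod.instIsAddHaarMeasure volume volume

lemma integral_phaseSpace {F : PhaseSpace d → ℂ} (hF : Integrable F) :
    ∫ Y, F Y = ∫ y, ∫ η, F (y, η) := integral_prod F hF

lemma integrable_temperate_mul (f : 𝓢(PhaseSpace d, ℂ)) {m : PhaseSpace d → ℂ}
    (hm : m.HasTemperateGrowth) : Integrable (fun Y => m Y * f Y) := by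
  obtain ⟨H, hH⟩ := SchwartzMap.exists_temperate_mul f hm
  simpa only [← hH] using H.integrable

/-- The partial Fourier transform in the momentum variable, expressed through the symplectic
Fourier transform. -/
lemma integral_symplecticFourier_momentum (f : 𝓢(PhaseSpace d, ℂ))
    (x y : EuclideanSpace ℝ (Fin d)) :
    ∫ η, Complex.exp (Complex.I * (-inner ℝ x η : ℝ)) * symplecticFourier f (y, η) =
      ∫ ζ, Complex.exp (Complex.I * (-inner ℝ y ζ : ℝ)) * f (x, ζ) := by
  obtain ⟨H, hH⟩ := SchwartzMap.exists_temperate_mul f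
    (m := fun p => Complex.exp (Complex.I * (-inner ℝ y p.2 : ℝ))) (by fun_prop)
  obtain ⟨G, hG⟩ :=
    SchwartzMap.exists_integral_fiber (volume : Measure (EuclideanSpace ℝ (Fin d))) H
  simp only [hH] at hG
  -- With `G(x') = ∫ e^{-iy·ζ} f(x', ζ) dζ`, the transform at `(y, η)` is `(2π)⁻ᵈ ∫ e^{iη·x'} G(x')
  -- dx'`; the integral over `η` inverts it at `x`.
  rw [← hG, ← fourier_inversion' G x, ← integral_const_mul]
  congr 1 with η
  rw [symplecticFourier, integral_phaseSpace (integrable_temperate_mul f (by fun_prop)),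
    mul_left_comm]
  congr 3 with x'
  rw [hG, ← integral_const_mul]
  congr 1 with ζ
  rw [← mul_assoc, ← Complex.exp_add]
  congr 2
  simp only [symplecticForm]
  push_cast
  ring

/-- The weight does not involve momentum, so the momentum integral is a Fourier inversion and only
the slice of `f` at position `X.1` survives. -/
lemma integral_mul_symplecticFourier (f : 𝓢(PhaseSpace d, ℂ))
    {m : EuclideanSpace ℝ (Fin d) → ℂ} (hm : m.HasTemperateGrowth) (X : PhaseSpace d) :
    ∫ Y : PhaseSpace d,
      Complex.exp (Complex.I * (symplecticForm X Y : ℂ)) * m Y.1 * symplecticFourier f Y =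
    ∫ y, Complex.exp (Complex.I * (inner ℝ X.2 y : ℝ)) * (m y *
      ∫ ζ, Complex.exp (Complex.I * (-inner ℝ y ζ : ℝ)) * f (X.1, ζ)) := by
  obtain ⟨F, hF⟩ := exists_schwartz_symplecticFourier f
  have hm' : (fun Y : PhaseSpace d => m Y.1).HasTemperateGrowth :=
    hm.comp Function.HasTemperateGrowth.id'.fst
  rw [← hF, integral_phaseSpace (integrable_temperate_mul F (by fun_prop))]
  congr 1 with y
  rw [← integral_symplecticFourier_momentum, ← hF, ← mul_assoc, ← integral_const_mul]
  congr 1 with η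
  rw [show symplecticForm X (y, η) = inner ℝ X.2 y + -inner ℝ X.1 η from sub_eq_add_neg _ _]
  push_cast
  rw [mul_add, Complex.exp_add]
  ring

lemma exists_schwartz_slice (f : 𝓢(PhaseSpace d, ℂ)) (x : EuclideanSpace ℝ (Fin d)) :
    ∃ h : 𝓢(EuclideanSpace ℝ (Fin d), ℂ), ∀ ξ, h ξ = f (x, ξ) := by
  have hg : (fun ξ : EuclideanSpace ℝ (Fin d) => ((x, ξ) : PhaseSpace d)).HasTemperateGrowth := by
    have := (Function.HasTemperateGrowth.const (E := EuclideanSpace ℝ (Fin d))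
      ((x, 0) : PhaseSpace d)).add
      (ContinuousLinearMap.inr ℝ (EuclideanSpace ℝ (Fin d))
        (EuclideanSpace ℝ (Fin d))).hasTemperateGrowth
    convert this using 1
    ext ξ <;> simp
  exact ⟨SchwartzMap.compCLM ℂ hg ⟨1, 1, fun ξ => by
    have : ‖ξ‖ ≤ ‖(x, ξ)‖ := le_max_right _ _
    simp only [pow_one, one_mul]; linarith⟩ f, fun ξ => rfl⟩

/-- The symplectic Fourier transform is an involution. -/
lemma symplecticFourier_symplecticFourier (f : 𝓢(PhaseSpace d, ℂ)) (X : PhaseSpace d) :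
    symplecticFourier (symplecticFourier f) X = f X := by
  obtain ⟨h, hh⟩ := exists_schwartz_slice f X.1
  have := integral_mul_symplecticFourier f (Function.HasTemperateGrowth.const 1) X
  simp only [mul_one, one_mul] at this
  rw [symplecticFourier, this]
  simp only [← hh, fourier_inversion]

end SymplecticFourier

/-! ### The Weyl product of Schwartz functions. -/

section WeylProduct

variable {d : ℕ}

/-- The Weyl product as a single integral, with the integral over the second factor carried out. -/
lemma weylProduct_eq_integral_left (ε : ℝ) (f : PhaseSpace d → ℂ) (g : 𝓢(PhaseSpace d, ℂ))
    (X : PhaseSpace d) :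
    weylProduct ε f g X = ((2 * Real.pi : ℝ) : ℂ)⁻¹ ^ d * ∫ Y : PhaseSpace d,
      Complex.exp (Complex.I * (symplecticForm X Y : ℂ)) * g (X + (ε / 2) • Y) *
        symplecticFourier f Y := by
  rw [weylProduct, two_mul d, pow_add, mul_assoc, ← integral_const_mul]
  congr 2 with Y
  -- Since `σ(X, Z) + (ε/2) σ(Y, Z) = σ(X + (ε/2)Y, Z)`, the integral over `Z` is an inversion at
  -- the shifted point.
  rw [← symplecticFourier_symplecticFourier g, symplecticFourier.eq_def (symplecticFourier g),
    mul_left_comm (Complex.exp _), mul_assoc]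
  congr 1
  rw [← integral_const_mul, ← integral_mul_const]
  congr 1 with Z
  rw [symplecticForm_add_right, symplecticForm_add_left, symplecticForm_smul_left]
  push_cast
  rw [mul_add, mul_add, Complex.exp_add, Complex.exp_add]
  ring

lemma symplecticForm_phase (ε : ℝ) (X Y Z : PhaseSpace d) :
    symplecticForm X Z + symplecticForm (X - (ε / 2) • Z) Y =
      symplecticForm X Y + symplecticForm (X + (ε / 2) • Y) Z := by
  rw [symplecticForm_add_left, symplecticForm_sub_left, symplecticForm_smul_left,
    symplecticForm_smul_left, symplecticForm_swap Z Y]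
  ring

lemma integral_integral_swap_of_schwartz (F G : 𝓢(PhaseSpace d, ℂ))
    {m : PhaseSpace d × PhaseSpace d → ℂ} (hm : m.HasTemperateGrowth) :
    ∫ Y, ∫ Z, m (Y, Z) * (F Y * G Z) = ∫ Z, ∫ Y, m (Y, Z) * (F Y * G Z) := by
  obtain ⟨H, hH⟩ := SchwartzMap.exists_temperate_mul_prod_mul F G hm
  have := integral_integral_swap (f := fun Y Z => H (Y, Z)) (μ := volume) (ν := volume)
    (H.integrable (μ := volume))
  simpa only [hH] using this

/-- The Weyl product as a single integral, with the integral over the first factor carried out. -/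
lemma weylProduct_eq_integral_right (ε : ℝ) (f g : 𝓢(PhaseSpace d, ℂ)) (X : PhaseSpace d) :
    weylProduct ε f g X = ((2 * Real.pi : ℝ) : ℂ)⁻¹ ^ d * ∫ Z : PhaseSpace d,
      Complex.exp (Complex.I * (symplecticForm X Z : ℂ)) * f (X - (ε / 2) • Z) *
        symplecticFourier g Z := by
  obtain ⟨F, hF⟩ := exists_schwartz_symplecticFourier f
  obtain ⟨G, hG⟩ := exists_schwartz_symplecticFourier g
  rw [weylProduct, two_mul d, pow_add, mul_assoc]
  simp only [← hF, ← hG, mul_assoc _ (F _) (G _)]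
  rw [integral_integral_swap_of_schwartz F G (m := fun p =>
    Complex.exp (Complex.I * (symplecticForm X (p.1 + p.2) : ℂ)) *
      Complex.exp (Complex.I * ((ε / 2 * symplecticForm p.1 p.2 : ℝ) : ℂ))) (by fun_prop),
    ← integral_const_mul]
  congr 2 with Z
  rw [← symplecticFourier_symplecticFourier f, ← hF, symplecticFourier,
    mul_left_comm (Complex.exp _), mul_assoc]
  congr 1
  rw [← integral_const_mul, ← integral_mul_const]
  congr 1 with Y
  rw [← mul_assoc (Complex.exp _) (Complex.exp _), ← Complex.exp_add, ← mul_add,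
    ← Complex.exp_add, ← mul_add, ← Complex.ofReal_add, ← Complex.ofReal_add,
    symplecticForm_phase, symplecticForm_add_right, symplecticForm_add_left,
    symplecticForm_smul_left, add_assoc]
  ring

/-- The Weyl product of Schwartz functions is a Schwartz function. -/
lemma exists_schwartz_weylProduct (ε : ℝ) (f g : 𝓢(PhaseSpace d, ℂ)) :
    ∃ p : 𝓢(PhaseSpace d, ℂ), ⇑p = weylProduct ε f g := by
  obtain ⟨F, hF⟩ := exists_schwartz_symplecticFourier f
  obtain ⟨H, hH⟩ := SchwartzMap.exists_prod_mul g F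
  -- The shear `(X, Y) ↦ (X + (ε/2)Y, Y)` is invertible, so it preserves Schwartz functions.
  let T : (PhaseSpace d × PhaseSpace d) →L[ℝ] PhaseSpace d × PhaseSpace d :=
    ContinuousLinearMap.prod (.fst ℝ _ _ + (ε / 2) • .snd ℝ _ _)
      (.snd ℝ _ _)
  let S : (PhaseSpace d × PhaseSpace d) →L[ℝ] PhaseSpace d × PhaseSpace d :=
    ContinuousLinearMap.prod (.fst ℝ _ _ - (ε / 2) • .snd ℝ _ _)
      (.snd ℝ _ _)
  let e : (PhaseSpace d × PhaseSpace d) ≃L[ℝ] PhaseSpace d × PhaseSpace d :=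
    ContinuousLinearEquiv.equivOfInverse T S (fun p => by simp [T, S]) (fun p => by simp [T, S])
  obtain ⟨K, hK⟩ := SchwartzMap.exists_temperate_mul
    (SchwartzMap.compCLMOfContinuousLinearEquiv ℂ e H)
    (m := fun p => Complex.exp (Complex.I * (symplecticForm p.1 p.2 : ℂ))) (by fun_prop)
  obtain ⟨p, hp⟩ := K.exists_integral_fiber (volume : Measure (PhaseSpace d))
  refine ⟨((2 * Real.pi : ℝ) : ℂ)⁻¹ ^ d • p, funext fun X => ?_⟩
  rw [weylProduct_eq_integral_left, smul_apply, hp, smul_eq_mul]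
  congr 2 with Y
  rw [hK, ← hF, mul_assoc]
  simp [e, T, hH]

lemma integrable_weyl_left (ε : ℝ) (f g : 𝓢(PhaseSpace d, ℂ)) (X : PhaseSpace d) :
    Integrable fun Y : PhaseSpace d => Complex.exp (Complex.I * (symplecticForm X Y : ℂ)) *
      g (X + (ε / 2) • Y) * symplecticFourier f Y := by
  obtain ⟨F, hF⟩ := exists_schwartz_symplecticFourier f
  rw [← hF]
  refine integrable_temperate_mul F (.mul (by fun_prop) ?_)
  exact g.hasTemperateGrowth.comp (by fun_prop)

lemma integrable_weyl_right (ε : ℝ) (f g : 𝓢(PhaseSpace d, ℂ)) (X : PhaseSpace d) :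
    Integrable fun Z : PhaseSpace d => Complex.exp (Complex.I * (symplecticForm X Z : ℂ)) *
      f (X - (ε / 2) • Z) * symplecticFourier g Z := by
  obtain ⟨G, hG⟩ := exists_schwartz_symplecticFourier g
  rw [← hG]
  refine integrable_temperate_mul G (.mul (by fun_prop) ?_)
  exact f.hasTemperateGrowth.comp (by fun_prop)

lemma weylProduct_add_smul_left (ε : ℝ) (f g h : 𝓢(PhaseSpace d, ℂ)) (α : ℂ) :
    weylProduct ε ⇑(f + α • g) h = weylProduct ε f h + α • weylProduct ε g h := by
  ext X
  simp only [Pi.add_apply, Pi.smul_apply, smul_eq_mul, weylProduct_eq_integral_right]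
  rw [mul_left_comm, ← mul_add, ← integral_const_mul α, ← integral_add
    (integrable_weyl_right ε f h X) ((integrable_weyl_right ε g h X).const_mul α)]
  congr 2 with Z
  simp only [add_apply, smul_apply, smul_eq_mul]
  ring

lemma weylProduct_add_smul_right (ε : ℝ) (f g h : 𝓢(PhaseSpace d, ℂ)) (α : ℂ) :
    weylProduct ε f ⇑(g + α • h) = weylProduct ε f g + α • weylProduct ε f h := by
  ext X
  simp only [Pi.add_apply, Pi.smul_apply, smul_eq_mul, weylProduct_eq_integral_left]
  rw [mul_left_comm, ← mul_add, ← integral_const_mul α, ← integral_add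
    (integrable_weyl_left ε f g X) ((integrable_weyl_left ε f h X).const_mul α)]
  congr 2 with Z
  simp only [add_apply, smul_apply, smul_eq_mul]
  ring

lemma weylProduct_assoc (ε : ℝ) (f g h : 𝓢(PhaseSpace d, ℂ)) :
    weylProduct ε (weylProduct ε f g) h = weylProduct ε f (weylProduct ε g h) := by
  ext X
  obtain ⟨p, hp⟩ := exists_schwartz_weylProduct ε f g
  obtain ⟨q, hq⟩ := exists_schwartz_weylProduct ε g h
  obtain ⟨F, hF⟩ := exists_schwartz_symplecticFourier f
  obtain ⟨G, hG⟩ := exists_schwartz_symplecticFourier h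
  rw [← hp, ← hq, weylProduct_eq_integral_right, weylProduct_eq_integral_left, hp, hq]
  simp only [weylProduct_eq_integral_right ε g, weylProduct_eq_integral_left ε _ g]
  congr 1
  have hm : (fun p : PhaseSpace d × PhaseSpace d => ((2 * Real.pi : ℝ) : ℂ)⁻¹ ^ d *
      Complex.exp (Complex.I * ((symplecticForm X p.1 +
        symplecticForm (X + (ε / 2) • p.1) p.2 : ℝ) : ℂ)) *
      g (X + (ε / 2) • p.1 - (ε / 2) • p.2)).HasTemperateGrowth :=
    .mul (by fun_prop) (g.hasTemperateGrowth.comp (by fun_prop))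
  have hswap := integral_integral_swap_of_schwartz F G hm
  rw [← hF, ← hG]
  refine Eq.trans ?_ (hswap.symm.trans ?_)
  · congr 1 with Z
    rw [mul_assoc, mul_assoc, ← integral_mul_const, ← integral_const_mul, ← integral_const_mul]
    congr 1 with Y
    rw [← symplecticForm_phase, show X - (ε / 2) • Z + (ε / 2) • Y =
      X + (ε / 2) • Y - (ε / 2) • Z by abel]
    push_cast
    rw [mul_add, Complex.exp_add]
    ring
  · congr 1 with Y
    rw [mul_assoc, mul_assoc, ← integral_mul_const, ← integral_const_mul, ← integral_const_mul]
    congr 1 with Z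
    push_cast
    rw [mul_add, Complex.exp_add]
    ring

lemma measurePreserving_phaseRotation : MeasurePreserving (phaseRotation d) :=
  ((MeasurePreserving.id volume).prod (Measure.measurePreserving_neg volume)).comp
    (Measure.measurePreserving_swap (μ := volume) (ν := volume))

lemma integral_comp_phaseRotation (F : PhaseSpace d → ℂ) :
    ∫ Y, F (phaseRotation d Y) = ∫ Y, F Y :=
  measurePreserving_phaseRotation.integral_comp
    (phaseRotation d).toHomeomorph.measurableEmbedding F

lemma symplecticFourier_comp_phaseRotation (f : PhaseSpace d → ℂ) (X : PhaseSpace d) :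
    symplecticFourier (fun Y => f (phaseRotation d Y)) X =
      symplecticFourier f (phaseRotation d X) := by
  rw [symplecticFourier, symplecticFourier]
  congr 1
  refine Eq.trans ?_ (integral_comp_phaseRotation _)
  simp only [symplecticForm_phaseRotation]

/-- The rotation preserves both `σ` and the volume. -/
lemma weylProduct_comp_phaseRotation (ε : ℝ) (f g : PhaseSpace d → ℂ) (X : PhaseSpace d) :
    weylProduct ε (fun Y => f (phaseRotation d Y)) (fun Y => g (phaseRotation d Y)) X =
      weylProduct ε f g (phaseRotation d X) := by
  rw [weylProduct, weylProduct]
  congr 1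
  refine Eq.trans ?_ (integral_comp_phaseRotation _)
  congr 1 with Y
  refine Eq.trans ?_ (integral_comp_phaseRotation _)
  simp only [symplecticFourier_comp_phaseRotation, ← map_add, symplecticForm_phaseRotation]

/-- For `d = 0` phase space is a point and the shift is invisible; for `d ≥ 1` decay along the
momentum direction forces `f = 0`. -/
lemma weylProduct_eq_mul_of_position (ε : ℝ) (f g : 𝓢(PhaseSpace d, ℂ))
    (hf : ∀ x ξ ξ', f (x, ξ) = f (x, ξ')) : weylProduct ε f g = f * g := by
  rcases Nat.eq_zero_or_pos d with rfl | hd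
  · ext X
    rw [weylProduct_eq_integral_left, Pi.mul_apply, ← symplecticFourier_symplecticFourier f X,
      symplecticFourier, mul_assoc, ← integral_mul_const]
    congr 2 with Y
    rw [Subsingleton.elim (X + (ε / 2) • Y) X]
    ring
  · have hz : ⇑f = 0 := by
      ext ⟨x, ξ⟩
      obtain ⟨C, hC0, hC⟩ := f.decay 1 0
      simp only [pow_one, norm_iteratedFDeriv_zero] at hC
      by_contra hne
      have hpos : 0 < ‖f (x, ξ)‖ := norm_pos_iff.2 hne
      -- A momentum so large that `‖(x, ζ)‖ * ‖f (x, ζ)‖` exceeds the decay bound `C`.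
      let ζ : EuclideanSpace ℝ (Fin d) := EuclideanSpace.single ⟨0, hd⟩ (C / ‖f (x, ξ)‖ + 1)
      have h1 : C / ‖f (x, ξ)‖ + 1 ≤ ‖(x, ζ)‖ := by
        refine le_trans ?_ (le_max_right _ _)
        simpa [ζ] using le_abs_self (C / ‖f (x, ξ)‖ + 1)
      have h2 := hC (x, ζ)
      rw [hf x ζ ξ] at h2
      have h3 : (C / ‖f (x, ξ)‖ + 1) * ‖f (x, ξ)‖ ≤ C := le_trans (by gcongr) h2
      rw [add_mul, div_mul_cancel₀ _ hpos.ne'] at h3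
      linarith
    ext X
    simp [hz, weylProduct, symplecticFourier]

lemma weylProduct_eq_mul_of_momentum (ε : ℝ) (f g : 𝓢(PhaseSpace d, ℂ))
    (hf : ∀ x x' ξ, f (x, ξ) = f (x', ξ)) : weylProduct ε f g = f * g := by
  let e := SchwartzMap.compCLMOfContinuousLinearEquiv ℂ (F := ℂ) (phaseRotation d)
  have h := weylProduct_eq_mul_of_position ε (e f) (e g) fun x ξ ξ' => hf ξ ξ' (-x)
  ext X
  have := congrFun h ((phaseRotation d).symm X)
  have h2 := weylProduct_comp_phaseRotation ε f g ((phaseRotation d).symm X)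
  rw [(phaseRotation d).apply_symm_apply] at h2
  rw [← h2]
  refine this.trans ?_
  simp [e, -phaseRotation_apply]

end WeylProduct

/-! ### Symbols of temperate growth and removal of the cut-offs. -/

section Oscillatory

variable {d : ℕ}

/-- The Jacobian of `Y = δ U` cancels the scaling factor of the transform, so the dilation passes to
`G`. -/
lemma integral_mul_symplecticFourier_comp_smul (G χ : PhaseSpace d → ℂ) {δ : ℝ} (hδ : δ ≠ 0) :
    ∫ Y, G Y * symplecticFourier (fun Z => χ (δ • Z)) Y =
      ∫ U, G (δ • U) * symplecticFourier χ U := by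
  set r := |(δ ^ Module.finrank ℝ (PhaseSpace d))⁻¹|
  have hr : r ≠ 0 := by positivity
  have h : ∀ U, symplecticFourier (fun Z => χ (δ • Z)) (δ • U) = r • symplecticFourier χ U := by
    intro U
    have := Measure.integral_comp_smul (volume : Measure (PhaseSpace d))
      (fun Y => Complex.exp (Complex.I * (symplecticForm U Y : ℂ)) * χ Y) δ
    rw [symplecticFourier, symplecticFourier, ← mul_smul_comm, ← this]
    simp only [symplecticForm_smul_left, symplecticForm_smul_right]
  have := Measure.integral_comp_smul (volume : Measure (PhaseSpace d))
    (fun Y => G Y * symplecticFourier (fun Z => χ (δ • Z)) Y) δ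
  simp only [h, mul_smul_comm, integral_smul] at this
  exact (smul_right_injective ℂ hr this).symm

/-- Both integrals see their symbol only at position `X.1`, where the factor is the constant `a
X.1`. -/
lemma integral_mul_symplecticFourier_position_mul (f p : 𝓢(PhaseSpace d, ℂ))
    {a m : EuclideanSpace ℝ (Fin d) → ℂ} (hp : ∀ Y, p Y = f Y * a Y.1)
    (hm : m.HasTemperateGrowth) (X : PhaseSpace d) :
    ∫ Y : PhaseSpace d,
      Complex.exp (Complex.I * (symplecticForm X Y : ℂ)) * m Y.1 * symplecticFourier p Y =
    a X.1 * ∫ Y : PhaseSpace d,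
      Complex.exp (Complex.I * (symplecticForm X Y : ℂ)) * m Y.1 * symplecticFourier f Y := by
  rw [integral_mul_symplecticFourier p hm, integral_mul_symplecticFourier f hm,
    ← integral_const_mul]
  congr 1 with y
  simp only [hp, ← mul_assoc, integral_mul_const]
  ring

lemma exists_schwartz_cutoff (χ : 𝓢(PhaseSpace d, ℂ)) {δ : ℝ} (hδ : δ ≠ 0)
    {a : PhaseSpace d → ℂ} (ha : a.HasTemperateGrowth) :
    ∃ p : 𝓢(PhaseSpace d, ℂ), ∀ Y, p Y = χ (δ • Y) * a Y := by
  obtain ⟨p, hp⟩ := SchwartzMap.exists_temperate_mul (SchwartzMap.compCLMOfContinuousLinearEquiv ℂ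
    (ContinuousLinearEquiv.smulLeft (Units.mk0 δ hδ)) χ) ha
  exact ⟨p, fun Y => by rw [hp, mul_comm]; rfl⟩

lemma symplecticForm_cutoff_phase (t δ : ℝ) (X Y V : PhaseSpace d) :
    symplecticForm X Y + symplecticForm (δ • (X + t • Y)) V =
      symplecticForm X (δ • V) + symplecticForm (X - (t * δ) • V) Y := by
  simp only [symplecticForm_add_left, symplecticForm_sub_left, symplecticForm_smul_left,
    symplecticForm_smul_right, symplecticForm_swap V Y]
  ring

/-- The integrand in the representation of the Weyl product of two cut-off functions of position
as an integral against the symplectic Fourier transforms of the cut-offs. -/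
noncomputable def cutoffWeylIntegrand (ε : ℝ) (a b : EuclideanSpace ℝ (Fin d) → ℂ)
    (X : PhaseSpace d) (δ : ℝ × ℝ) (p : PhaseSpace d × PhaseSpace d) : ℂ :=
  Complex.exp (Complex.I * ((symplecticForm X (δ.2 • p.1) +
    symplecticForm (X - (ε / 2 * δ.2) • p.1) (δ.1 • p.2) : ℝ) : ℂ)) *
    (a (X - (ε / 2 * δ.2) • p.1).1 * b (X + (ε / 2 * δ.1) • p.2).1)

lemma hasTemperateGrowth_cutoffWeylIntegrand (ε : ℝ) {a b : EuclideanSpace ℝ (Fin d) → ℂ}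
    (ha : a.HasTemperateGrowth) (hb : b.HasTemperateGrowth) (X : PhaseSpace d) (δ : ℝ × ℝ) :
    (cutoffWeylIntegrand ε a b X δ).HasTemperateGrowth := by
  refine .mul (by fun_prop) (.mul (ha.comp ?_) (hb.comp ?_)) <;> fun_prop

lemma weylProduct_cutoff (ε : ℝ) {a b : EuclideanSpace ℝ (Fin d) → ℂ}
    (ha : a.HasTemperateGrowth) (hb : b.HasTemperateGrowth) (χ ψ : 𝓢(PhaseSpace d, ℂ))
    {δ : ℝ × ℝ} (h₁ : δ.1 ≠ 0) (h₂ : δ.2 ≠ 0) (X : PhaseSpace d) :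
    weylProduct ε (fun Y => χ (δ.1 • Y) * a Y.1) (fun Z => ψ (δ.2 • Z) * b Z.1) X =
      ((2 * Real.pi : ℝ) : ℂ)⁻¹ ^ d * (((2 * Real.pi : ℝ) : ℂ)⁻¹ ^ d *
        ∫ p : PhaseSpace d × PhaseSpace d, cutoffWeylIntegrand ε a b X δ p *
          (symplecticFourier ψ p.1 * symplecticFourier χ p.2)) := by
  have ha' : (fun Y : PhaseSpace d => a Y.1).HasTemperateGrowth :=
    ha.comp Function.HasTemperateGrowth.id'.fst
  have hb' : (fun Y : PhaseSpace d => b Y.1).HasTemperateGrowth :=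
    hb.comp Function.HasTemperateGrowth.id'.fst
  obtain ⟨χδ, hχδ⟩ := exists_schwartz_cutoff χ h₁ (Function.HasTemperateGrowth.const 1)
  simp only [mul_one] at hχδ
  obtain ⟨f, hf⟩ := exists_schwartz_cutoff χ h₁ ha'
  obtain ⟨g, hg⟩ := exists_schwartz_cutoff ψ h₂ hb'
  obtain ⟨F, hF⟩ := exists_schwartz_symplecticFourier f
  obtain ⟨P, hP⟩ := exists_schwartz_symplecticFourier ψ
  obtain ⟨Q, hQ⟩ := exists_schwartz_symplecticFourier χ
  obtain ⟨H, hH⟩ := SchwartzMap.exists_temperate_mul_prod_mul P Q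
    (hasTemperateGrowth_cutoffWeylIntegrand ε ha hb X δ)
  rw [← funext hf, ← funext hg, weylProduct_eq_integral_left]
  congr 1
  have hm : (fun p : PhaseSpace d × PhaseSpace d =>
      Complex.exp (Complex.I * ((symplecticForm X p.1 +
        symplecticForm (δ.2 • (X + (ε / 2) • p.1)) p.2 : ℝ) : ℂ)) *
      b (X + (ε / 2) • p.1).1).HasTemperateGrowth :=
    .mul (by fun_prop) (hb.comp (by fun_prop))
  have hleft : ∫ Y : PhaseSpace d, Complex.exp (Complex.I * (symplecticForm X Y : ℂ)) *
      g (X + (ε / 2) • Y) * symplecticFourier f Y = ((2 * Real.pi : ℝ) : ℂ)⁻¹ ^ d *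
      ∫ Y, ∫ V, (Complex.exp (Complex.I * ((symplecticForm X Y +
        symplecticForm (δ.2 • (X + (ε / 2) • Y)) V : ℝ) : ℂ)) *
        b (X + (ε / 2) • Y).1) * (F Y * P V) := by
    rw [← integral_const_mul]
    congr 1 with Y
    rw [hg, ← symplecticFourier_symplecticFourier ψ, ← hP, ← hF, symplecticFourier]
    rw [show ∀ u v w z c : ℂ, u * (c * v * w) * z = c * (v * (u * w * z)) by intros; ring]
    congr 1
    rw [← integral_mul_const]
    congr 1 with V
    push_cast
    rw [mul_add, Complex.exp_add]
    ring
  rw [hleft]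
  congr 1
  rw [integral_integral_swap_of_schwartz F P hm]
  simp only [← hP, ← hQ, ← hH]
  rw [show ∫ p, H p = ∫ V, ∫ U, H (V, U) from
    integral_prod H (H.integrable (μ := volume))]
  congr 1 with V
  have hm' : (fun y : EuclideanSpace ℝ (Fin d) => b (X.1 + (ε / 2) • y)).HasTemperateGrowth :=
    hb.comp (by fun_prop)
  -- For fixed `V` the phase has base point `X - (ε/2 * δ.2) • V`; there `a` is pulled out, leaving
  -- the bare cut-off to be rescaled.
  have hpos := integral_mul_symplecticFourier_position_mul χδ f (a := a)
    (fun Y => by rw [hf, hχδ]) hm' (X - (ε / 2 * δ.2) • V)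
  rw [← hF, funext hχδ, integral_mul_symplecticFourier_comp_smul _ _ h₁, ← hQ] at hpos
  calc _ = Complex.exp (Complex.I * (symplecticForm X (δ.2 • V) : ℂ)) * P V *
      ∫ Y : PhaseSpace d,
        Complex.exp (Complex.I * (symplecticForm (X - (ε / 2 * δ.2) • V) Y : ℂ)) *
          b (X.1 + (ε / 2) • Y.1) * F Y := by
        rw [← integral_const_mul]
        congr 1 with Y
        rw [symplecticForm_cutoff_phase]
        push_cast
        rw [mul_add, Complex.exp_add]
        simp only [Prod.fst_add, Prod.smul_fst]
        ring
    _ = _ := by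
        rw [hpos, ← mul_assoc, ← integral_const_mul]
        congr 1 with U
        rw [hH, cutoffWeylIntegrand]
        push_cast
        rw [mul_add, Complex.exp_add]
        simp only [Prod.fst_add, Prod.smul_fst, smul_smul]
        ring

lemma integrable_affine_pow_mul_norm (f : 𝓢(PhaseSpace d, ℂ)) (A B : ℝ) (k : ℕ) :
    Integrable fun Y => (A + B * ‖Y‖) ^ k * ‖f Y‖ := by
  simp only [add_pow, Finset.sum_mul]
  refine integrable_finsetSum _ fun i _ => ?_
  refine ((f.integrable_pow_mul volume (k - i)).const_mul
    (A ^ i * B ^ (k - i) * (k.choose i : ℝ))).congr (ae_of_all _ fun Y => ?_)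
  simp only [mul_pow]
  ring

/-- For `|δ.1|, |δ.2| ≤ 1` the shifts are at most `|ε / 2|` times the variables, so `a` and `b` grow
polynomially uniformly in `δ`, and the Schwartz factors absorb this. -/
lemma exists_integrable_bound_cutoffWeylIntegrand (ε : ℝ) {a b : EuclideanSpace ℝ (Fin d) → ℂ}
    (ha : a.HasTemperateGrowth) (hb : b.HasTemperateGrowth) (X : PhaseSpace d)
    (P Q : 𝓢(PhaseSpace d, ℂ)) :
    ∃ B : PhaseSpace d × PhaseSpace d → ℝ, Integrable B ∧
      ∀ δ : ℝ × ℝ, |δ.1| ≤ 1 → |δ.2| ≤ 1 → ∀ p,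
        ‖cutoffWeylIntegrand ε a b X δ p * (P p.1 * Q p.2)‖ ≤ B p := by
  have key : ∀ {a : EuclideanSpace ℝ (Fin d) → ℂ}, a.HasTemperateGrowth → ∃ (k : ℕ) (C : ℝ),
      0 ≤ C ∧ ∀ (t : ℝ) (V : PhaseSpace d), |t| ≤ |ε / 2| →
        ‖a (X + t • V).1‖ ≤ C * ((1 + ‖X‖) + |ε / 2| * ‖V‖) ^ k := by
    intro a ha
    obtain ⟨k, C, hC, h⟩ := ha.norm_iteratedFDeriv_le_uniform 0
    refine ⟨k, C, hC, fun t V ht => ?_⟩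
    have h0 := h 0 le_rfl (X + t • V).1
    rw [norm_iteratedFDeriv_zero] at h0
    refine h0.trans ?_
    have h1 : ‖(X + t • V).1‖ ≤ ‖X‖ + |ε / 2| * ‖V‖ := by
      refine (norm_fst_le _).trans ((norm_add_le _ _).trans ?_)
      rw [norm_smul, Real.norm_eq_abs]
      gcongr
    rw [add_assoc]
    gcongr
  obtain ⟨k, C, hC, hk⟩ := key ha
  obtain ⟨l, D, hD, hl⟩ := key hb
  refine ⟨fun p => (C * D) * ((((1 + ‖X‖) + |ε / 2| * ‖p.1‖) ^ k * ‖P p.1‖) *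
    (((1 + ‖X‖) + |ε / 2| * ‖p.2‖) ^ l * ‖Q p.2‖)),
    ((integrable_affine_pow_mul_norm P _ _ k).mul_prod
      (integrable_affine_pow_mul_norm Q _ _ l)).const_mul _, fun δ h1 h2 p => ?_⟩
  have e1 : ‖a (X - (ε / 2 * δ.2) • p.1).1‖ ≤
      C * ((1 + ‖X‖) + |ε / 2| * ‖p.1‖) ^ k := by
    have := hk (-(ε / 2 * δ.2)) p.1 (by
      rw [abs_neg, abs_mul]; exact mul_le_of_le_one_right (abs_nonneg _) h2)
    rwa [neg_smul, ← sub_eq_add_neg] at this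
  have e2 := hl (ε / 2 * δ.1) p.2 (by
    rw [abs_mul]; exact mul_le_of_le_one_right (abs_nonneg _) h1)
  rw [cutoffWeylIntegrand, norm_mul, norm_mul, norm_mul, norm_mul, mul_comm Complex.I,
    Complex.norm_exp_ofReal_mul_I, one_mul]
  calc _ ≤ (C * ((1 + ‖X‖) + |ε / 2| * ‖p.1‖) ^ k * (D * ((1 + ‖X‖) + |ε / 2| * ‖p.2‖) ^ l)) *
        (‖P p.1‖ * ‖Q p.2‖) := by gcongr
    _ = _ := by ring

lemma integral_symplecticFourier (f : 𝓢(PhaseSpace d, ℂ)) :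
    ((2 * Real.pi : ℝ) : ℂ)⁻¹ ^ d * ∫ Y, symplecticFourier f Y = f 0 := by
  rw [← symplecticFourier_symplecticFourier f 0, symplecticFourier.eq_def (symplecticFourier f)]
  simp [symplecticForm]

lemma isOscillatoryWeylProduct_position (ε : ℝ) {a b : EuclideanSpace ℝ (Fin d) → ℂ}
    (ha : a.HasTemperateGrowth) (hb : b.HasTemperateGrowth) :
    IsOscillatoryWeylProduct ε (fun X : PhaseSpace d => a X.1) (fun X => b X.1)
      (fun X => a X.1 * b X.1) := by
  intro χ ψ hχ hψ X
  obtain ⟨P, hP⟩ := exists_schwartz_symplecticFourier ψ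
  obtain ⟨Q, hQ⟩ := exists_schwartz_symplecticFourier χ
  obtain ⟨B, hB, hle⟩ := exists_integrable_bound_cutoffWeylIntegrand ε ha hb X P Q
  have hpos : ∀ᶠ δ : ℝ × ℝ in 𝓝[>] (0 : ℝ) ×ˢ 𝓝[>] (0 : ℝ),
      (0 < δ.1 ∧ δ.1 < 1) ∧ (0 < δ.2 ∧ δ.2 < 1) :=
    prod_mem_prod (Ioo_mem_nhdsGT one_pos) (Ioo_mem_nhdsGT one_pos)
  have hle0 : 𝓝[>] (0 : ℝ) ×ˢ 𝓝[>] (0 : ℝ) ≤ 𝓝 ((0 : ℝ), (0 : ℝ)) := by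
    rw [nhds_prod_eq]
    exact prod_mono nhdsWithin_le_nhds nhdsWithin_le_nhds
  have hlim : Tendsto (fun δ : ℝ × ℝ => ∫ p : PhaseSpace d × PhaseSpace d,
      cutoffWeylIntegrand ε a b X δ p * (P p.1 * Q p.2)) (𝓝[>] (0 : ℝ) ×ˢ 𝓝[>] (0 : ℝ))
      (𝓝 (∫ p : PhaseSpace d × PhaseSpace d,
        cutoffWeylIntegrand ε a b X (0, 0) p * (P p.1 * Q p.2))) := by
    refine tendsto_integral_filter_of_dominated_convergence B (.of_forall fun δ => ?_)
      (hpos.mono fun δ hδ => ae_of_all _ (hle δ ?_ ?_)) hB (ae_of_all _ fun p => ?_)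
    · have := (hasTemperateGrowth_cutoffWeylIntegrand ε ha hb X δ).1.continuous
      exact Continuous.aestronglyMeasurable (by fun_prop)
    · rw [abs_of_pos hδ.1.1]
      exact hδ.1.2.le
    · rw [abs_of_pos hδ.2.1]
      exact hδ.2.2.le
    · have hac := ha.1.continuous
      have hbc := hb.1.continuous
      have : Continuous fun δ : ℝ × ℝ => cutoffWeylIntegrand ε a b X δ p * (P p.1 * Q p.2) := by
        unfold cutoffWeylIntegrand symplecticForm
        fun_prop
      exact (this.tendsto (0, 0)).mono_left hle0
  have hval : ((2 * Real.pi : ℝ) : ℂ)⁻¹ ^ d * (((2 * Real.pi : ℝ) : ℂ)⁻¹ ^ d *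
      ∫ p : PhaseSpace d × PhaseSpace d,
        cutoffWeylIntegrand ε a b X (0, 0) p * (P p.1 * Q p.2)) = a X.1 * b X.1 := by
    have h1 := integral_symplecticFourier χ
    have h2 := integral_symplecticFourier ψ
    rw [hχ, ← hQ] at h1
    rw [hψ, ← hP] at h2
    -- At `δ = 0` phase and shifts vanish, and the integral factors into `ψ 0` and `χ 0`.
    have h3 : ∀ p, cutoffWeylIntegrand ε a b X (0, 0) p = a X.1 * b X.1 := by
      intro p
      simp [cutoffWeylIntegrand, symplecticForm]
    simp only [h3]
    rw [integral_const_mul, show ∫ p : PhaseSpace d × PhaseSpace d, P p.1 * Q p.2 =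
      (∫ V, P V) * ∫ U, Q U from integral_prod_mul P Q]
    linear_combination (a X.1 * b X.1) * (((2 * Real.pi : ℝ) : ℂ)⁻¹ ^ d * ∫ V, P V) * h1 +
      (a X.1 * b X.1) * h2
  beta_reduce
  rw [← hval]
  refine ((hlim.const_mul _).const_mul _).congr' (hpos.mono fun δ hδ => ?_)
  beta_reduce
  rw [weylProduct_cutoff ε ha hb χ ψ hδ.1.1.ne' hδ.2.1.ne' X, hP, hQ]

lemma isOscillatoryWeylProduct_momentum (ε : ℝ) {a b : EuclideanSpace ℝ (Fin d) → ℂ}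
    (ha : a.HasTemperateGrowth) (hb : b.HasTemperateGrowth) :
    IsOscillatoryWeylProduct ε (fun X : PhaseSpace d => a X.2) (fun X => b X.2)
      (fun X => a X.2 * b X.2) := by
  intro χ ψ hχ hψ X
  -- Rotating the cut-offs back keeps their value at 0 and commutes with dilations.
  let e := SchwartzMap.compCLMOfContinuousLinearEquiv ℂ (F := ℂ) (phaseRotation d).symm
  have h := isOscillatoryWeylProduct_position ε ha hb (e χ) (e ψ) (by simp [e, hχ])
    (by simp [e, hψ]) (phaseRotation d X)
  refine h.congr fun δ => ?_
  rw [← weylProduct_comp_phaseRotation]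
  simp only [e, SchwartzMap.compCLMOfContinuousLinearEquiv_apply, Function.comp_apply,
    ← map_smul (phaseRotation d), ContinuousLinearEquiv.symm_apply_apply]
  simp only [phaseRotation_apply]

end Oscillatory

theorem mainTheorem9 (d : ℕ) (ε : ℝ) (hε : 0 < ε) :
    -- the Weyl product of Schwartz functions is a Schwartz function
    (∀ f g : 𝓢(PhaseSpace d, ℂ), ∃ p : 𝓢(PhaseSpace d, ℂ), ⇑p = weylProduct ε ⇑f ⇑g) ∧
    -- bilinearity
    (∀ (f g h : 𝓢(PhaseSpace d, ℂ)) (α : ℂ),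
      weylProduct ε ⇑(f + α • g) ⇑h = weylProduct ε ⇑f ⇑h + α • weylProduct ε ⇑g ⇑h) ∧
    (∀ (f g h : 𝓢(PhaseSpace d, ℂ)) (α : ℂ),
      weylProduct ε ⇑f ⇑(g + α • h) = weylProduct ε ⇑f ⇑g + α • weylProduct ε ⇑f ⇑h) ∧
    -- associativity
    (∀ f g h : 𝓢(PhaseSpace d, ℂ),
      weylProduct ε (weylProduct ε ⇑f ⇑g) ⇑h = weylProduct ε ⇑f (weylProduct ε ⇑g ⇑h)) ∧
    -- functions of position: Schwartz functions on phase space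
    (∀ f g : 𝓢(PhaseSpace d, ℂ),
      (∀ x ξ ξ', f (x, ξ) = f (x, ξ')) → (∀ x ξ ξ', g (x, ξ) = g (x, ξ')) →
        weylProduct ε ⇑f ⇑g = ⇑f * ⇑g) ∧
    -- functions of position: arbitrary smooth functions of temperate growth on `ℝᵈ`
    (∀ a b : EuclideanSpace ℝ (Fin d) → ℂ, a.HasTemperateGrowth → b.HasTemperateGrowth →
      IsOscillatoryWeylProduct ε (fun X => a X.1) (fun X => b X.1)
        (fun X => a X.1 * b X.1)) ∧
    -- functions of momentum: Schwartz functions on phase space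
    (∀ f g : 𝓢(PhaseSpace d, ℂ),
      (∀ x x' ξ, f (x, ξ) = f (x', ξ)) → (∀ x x' ξ, g (x, ξ) = g (x', ξ)) →
        weylProduct ε ⇑f ⇑g = ⇑f * ⇑g) ∧
    -- functions of momentum: arbitrary smooth functions of temperate growth on `ℝᵈ`
    (∀ a b : EuclideanSpace ℝ (Fin d) → ℂ, a.HasTemperateGrowth → b.HasTemperateGrowth →
      IsOscillatoryWeylProduct ε (fun X => a X.2) (fun X => b X.2)
        (fun X => a X.2 * b X.2)) := by
  exact ⟨exists_schwartz_weylProduct ε, weylProduct_add_smul_left ε, weylProduct_add_smul_right ε,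
    weylProduct_assoc ε, fun f g hf _ => weylProduct_eq_mul_of_position ε f g hf,
    fun _ _ => isOscillatoryWeylProduct_position ε,
    fun f g hf _ => weylProduct_eq_mul_of_momentum ε f g hf,
    fun _ _ => isOscillatoryWeylProduct_momentum ε⟩
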